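/- Let $G$ and $H$ be locally compact (Hausdorff) groups. Let $M(G)=C_0(G)'$ be the Banach algebra of regular finite complex Borel measures on $G$ under convolution, $\langle\mu\lambda,f\rangle=\int_{G\times G} f(st)\,d\mu(s)\,d\lambda(t)$ $(\mu,\lambda\in M(G),\ f\in C_0(G))$, and let $\Gamma_G:M(G)\to M(G\times G)$ be given by $\langle\Gamma_G(\mu),f\rangle=\int_G f(s,s)\,d\mu(s)$ $(f\in C_0(G\times G))$; define $M(H)$ and $\Gamma_H$ in the same way. Let $\theta:M(G)\to M(H)$ be a Banach algebra isomorphism, that is, an algebra isomorphism which is bounded with bounded inverse (not assumed isometric). Let $\theta\otimes\theta:M(G\times G)\to M(H\times H)$ be the bounded linear map determined by $$\langle(\theta\otimes\theta)(\mu),f\otimes g\rangle=\langle\theta'(f)\otimes\theta'(g),\mu\rangle\qquad(\mu\in M(G\times G),\ f,g\in C_0(H)),$$ where $\theta'(f)\in M(G)'$ is the functional $\lambda\mapsto\langle\theta(\lambda),f\rangle$ and, for $\Phi,\Psi\in M(G)'$, $\langle\Phi\otimes\Psi,\mu\rangle=\Phi(\mu_\Psi)$, with $\mu_\Psi\in M(G)=C_0(G)'$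 given by $\langle\mu_\Psi,h\rangle=\Psi\big(k\mapsto\langle\mu,h\otimes k\rangle\big)$ $(h,k\in C_0(G))$. Suppose that $$(\theta\otimes\theta)\Gamma_G=\Gamma_H\theta .$$ Then there is an isomorphism of topological groups $\alpha:G\to H$ such that $$\langle\theta(\mu),f\rangle=\int_G f(\alpha(s))\,d\mu(s)\qquad(\mu\in M(G),\ f\in C_0(H)).$$ In particular, $\theta$ is continuous for the weak$^*$-topologies on $M(G)=C_0(G)'$ and $M(H)=C_0(H)'$. -/

import Mathlib

open Filter Topology Set
open scoped ZeroAtInfty TensorProduct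

set_option maxSynthPendingDepth 3

noncomputable section

namespace MeasureAlgebra

/-- `M(X)`: the Banach space of regular complex Borel measures of finite total variation on a
locally compact Hausdorff space `X`, taken as the Banach dual of `C₀(X)` (total variation is the
dual norm). For `μ : M X` and `f ∈ C₀(X)`, the number `μ f` is the integral `∫ f dμ`. -/
abbrev M (X : Type*) [TopologicalSpace X] : Type _ := StrongDual ℂ C₀(X, ℂ)

section Basic

variable {X Y Z : Type*} [TopologicalSpace X] [TopologicalSpace Y] [TopologicalSpace Z]

theorem norm_apply_le (f : C₀(X, ℂ)) (x : X) : ‖f x‖ ≤ ‖f‖ := by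
  rw [← ZeroAtInftyContinuousMap.norm_toBCF_eq_norm]
  exact f.toBCF.norm_coe_le_norm x

theorem norm_le_of {f : C₀(X, ℂ)} {C : ℝ} (hC : 0 ≤ C) (h : ∀ x, ‖f x‖ ≤ C) : ‖f‖ ≤ C := by
  rw [← ZeroAtInftyContinuousMap.norm_toBCF_eq_norm]
  exact (BoundedContinuousFunction.norm_le hC).2 h

/-- The point mass at `x`. -/
def dirac (x : X) : M X :=
  LinearMap.mkContinuous
    { toFun := fun f => f x, map_add' := fun _ _ => rfl, map_smul' := fun _ _ => rfl } 1
    (fun f => by simpa using norm_apply_le f x)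

@[simp] theorem dirac_apply (x : X) (f : C₀(X, ℂ)) : dirac x f = f x := rfl

/-- Composition `f ↦ f ∘ p` with a proper continuous map, as a bounded map `C₀(Y) → C₀(X)`. -/
def compCLM (p : CocompactMap X Y) : C₀(Y, ℂ) →L[ℂ] C₀(X, ℂ) :=
  LinearMap.mkContinuous (ZeroAtInftyContinuousMap.compLinearMap p) 1 (fun f => by
    rw [one_mul]
    exact norm_le_of (norm_nonneg _) fun x => norm_apply_le f (p x))

@[simp] theorem compCLM_apply (p : CocompactMap X Y) (f : C₀(Y, ℂ)) (x : X) :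
    compCLM p f x = f (p x) := rfl

/-- The image measure under a proper continuous map `p`: `∫ f d(p_* μ) = ∫ f ∘ p dμ`. -/
def pushforward (p : CocompactMap X Y) : M X →L[ℂ] M Y :=
  (ContinuousLinearMap.compL ℂ C₀(Y, ℂ) C₀(X, ℂ) ℂ).flip (compCLM p)

@[simp] theorem pushforward_apply (p : CocompactMap X Y) (μ : M X) (f : C₀(Y, ℂ)) :
    pushforward p μ f = μ (f.comp p) := rfl

/-- The function `(x, y) ↦ f x * g y` in `C₀(X × Y)`. -/
def tmul (f : C₀(X, ℂ)) (g : C₀(Y, ℂ)) : C₀(X × Y, ℂ) where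
  toFun p := f p.1 * g p.2
  continuous_toFun := by fun_prop
  zero_at_infty' := by
    rw [← Filter.coprod_cocompact, Filter.coprod]
    refine Tendsto.sup ?_ ?_
    · refine Tendsto.zero_mul_isBoundedUnder_le
        ((ZeroAtInftyContinuousMapClass.zero_at_infty f).comp tendsto_comap) ?_
      exact isBoundedUnder_of ⟨‖g‖, fun p => norm_apply_le g p.2⟩
    · refine isBoundedUnder_le_mul_tendsto_zero ?_
        ((ZeroAtInftyContinuousMapClass.zero_at_infty g).comp tendsto_comap)
      exact isBoundedUnder_of ⟨‖f‖, fun p => norm_apply_le f p.1⟩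

@[simp] theorem tmul_apply (f : C₀(X, ℂ)) (g : C₀(Y, ℂ)) (p : X × Y) :
    tmul f g p = f p.1 * g p.2 := rfl

/-- `(f, g) ↦ f ⊗ g` as a bounded bilinear map `C₀(X) × C₀(Y) → C₀(X × Y)`. -/
def tmulCLM : C₀(X, ℂ) →L[ℂ] C₀(Y, ℂ) →L[ℂ] C₀(X × Y, ℂ) :=
  LinearMap.mkContinuous₂
    (LinearMap.mk₂ ℂ tmul
      (fun f f' g => by ext p; simp [add_mul])
      (fun c f g => by ext p; simp [mul_assoc])
      (fun f g g' => by ext p; simp [mul_add])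
      (fun c f g => by ext p; simp [mul_left_comm])) 1
    (fun f g => by
      rw [one_mul]
      refine norm_le_of (by positivity) fun p => ?_
      simp only [LinearMap.mk₂_apply, tmul_apply, norm_mul]
      gcongr
      · exact norm_apply_le f _
      · exact norm_apply_le g _)

@[simp] theorem tmulCLM_apply (f : C₀(X, ℂ)) (g : C₀(Y, ℂ)) : tmulCLM f g = tmul f g := rfl

/-- The slice `(f ⊗ id)(μ) ∈ M(Y)` of `μ ∈ M(X × Y)` by `f ∈ C₀(X)`:
`⟨(f ⊗ id)(μ), g⟩ = ⟨μ, f ⊗ g⟩`. -/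
def slice (f : C₀(X, ℂ)) (μ : M (X × Y)) : M Y := μ ∘L tmulCLM f

@[simp] theorem slice_apply (f : C₀(X, ℂ)) (μ : M (X × Y)) (g : C₀(Y, ℂ)) :
    slice f μ g = μ (tmul f g) := rfl

theorem slice_add_left (f f' : C₀(X, ℂ)) (μ : M (X × Y)) :
    slice (f + f') μ = slice f μ + slice f' μ := by
  simp [slice]

theorem slice_smul_left (c : ℂ) (f : C₀(X, ℂ)) (μ : M (X × Y)) :
    slice (c • f) μ = c • slice f μ := by
  simp [slice]

theorem slice_add_right (f : C₀(X, ℂ)) (μ ν : M (X × Y)) :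
    slice f (μ + ν) = slice f μ + slice f ν := rfl

theorem slice_smul_right (c : ℂ) (f : C₀(X, ℂ)) (μ : M (X × Y)) :
    slice f (c • μ) = c • slice f μ := rfl

/-- A bounded functional nearly attains its norm, at a real value. -/
theorem exists_near_norm {E : Type*} [NormedAddCommGroup E] [NormedSpace ℂ E]
    (φ : StrongDual ℂ E) {δ : ℝ} (hδ : 0 < δ) :
    ∃ g : E, ‖g‖ ≤ 1 ∧ ∃ r : ℝ, φ g = r ∧ ‖φ‖ - δ < r := by
  obtain ⟨x, hx, hr⟩ := φ.exists_lt_apply_of_lt_opNorm (show ‖φ‖ - δ < ‖φ‖ by linarith)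
  obtain ⟨c, hc, hcx⟩ := Complex.exists_norm_eq_mul_self (φ x)
  refine ⟨c • x, by rw [norm_smul, hc, one_mul]; exact hx.le, ‖φ x‖, ?_, hr⟩
  rw [map_smul, smul_eq_mul]
  exact hcx.symm

/-- The slices of `μ` by a partition of unity have total norm at most `‖μ‖`. -/
theorem sum_norm_slice_le (μ : M (X × Y)) {n : ℕ} (e : Fin n → C₀(X, ℂ))
    (he : ∀ y, ∑ j, ‖e j y‖ ≤ 1) : ∑ j, ‖slice (e j) μ‖ ≤ ‖μ‖ := by
  refine le_of_forall_pos_le_add fun δ hδ => ?_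
  have hδ' : 0 < δ / (n + 1) := by positivity
  choose g hg r hr hlt using fun j => exists_near_norm (slice (e j) μ) hδ'
  have hsum : μ (∑ j, tmul (e j) (g j)) = ((∑ j, r j : ℝ) : ℂ) := by
    rw [map_sum, Complex.ofReal_sum]
    exact Finset.sum_congr rfl fun j _ => hr j
  have hcoe : ∀ (p : X × Y) (s : Finset (Fin n)),
      (∑ j ∈ s, tmul (e j) (g j)) p = ∑ j ∈ s, e j p.1 * g j p.2 := by
    intro p s
    induction s using Finset.cons_induction with
    | empty => simp
    | cons a s ha ih =>
      rw [Finset.sum_cons, Finset.sum_cons, ZeroAtInftyContinuousMap.add_apply, ih]; rfl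
  have hnorm : ‖∑ j, tmul (e j) (g j)‖ ≤ 1 := by
    refine norm_le_of zero_le_one fun p => ?_
    rw [hcoe]
    refine (norm_sum_le _ _).trans ((Finset.sum_le_sum fun j _ => ?_).trans (he p.1))
    rw [norm_mul]
    exact mul_le_of_le_one_right (norm_nonneg _) ((norm_apply_le _ _).trans (hg j))
  have hle : ∑ j, r j ≤ ‖μ‖ := by
    calc ∑ j, r j ≤ ‖((∑ j, r j : ℝ) : ℂ)‖ := by
          rw [Complex.norm_real]; exact le_abs_self _
      _ = ‖μ (∑ j, tmul (e j) (g j))‖ := by rw [hsum]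
      _ ≤ ‖μ‖ * ‖∑ j, tmul (e j) (g j)‖ := μ.le_opNorm _
      _ ≤ ‖μ‖ := mul_le_of_le_one_right (norm_nonneg μ) hnorm
  calc ∑ j, ‖slice (e j) μ‖ ≤ ∑ j, (r j + δ / (n + 1)) :=
        Finset.sum_le_sum fun j _ => by linarith [hlt j]
    _ = ∑ j, r j + n * (δ / (n + 1)) := by
        simp [Finset.sum_add_distrib]
    _ ≤ ‖μ‖ + δ := by
        have : (n : ℝ) * (δ / (n + 1)) ≤ δ := by
          rw [mul_div_assoc', div_le_iff₀ (by positivity)]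
          nlinarith
        linarith

/-- A jointly continuous function whose partial functions vanish at infinity, locally uniformly
in the parameter, defines a norm-continuous map into `C₀(Y)`. -/
theorem continuous_of_locally_uniform (F : C(X × Y, ℂ)) (Φ : X → C₀(Y, ℂ))
    (hΦ : ∀ x y, Φ x y = F (x, y))
    (h : ∀ x₀, ∀ ε > 0, ∃ K : Set Y, IsCompact K ∧ ∀ᶠ x in 𝓝 x₀, ∀ y ∉ K, ‖F (x, y)‖ ≤ ε) :
    Continuous Φ := by
  rw [continuous_iff_continuousAt]
  intro x₀
  rw [ContinuousAt, Metric.tendsto_nhds]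
  intro ε hε
  obtain ⟨K, hK, hKF⟩ := h x₀ (ε / 4) (by positivity)
  have hc : Tendsto F.curry (𝓝 x₀) (𝓝 (F.curry x₀)) := F.curry.continuous.tendsto x₀
  rw [ContinuousMap.tendsto_iff_forall_isCompact_tendstoUniformlyOn] at hc
  have hK' := Metric.tendstoUniformlyOn_iff.1 (hc K hK) (ε / 2) (by positivity)
  filter_upwards [hKF, hK'] with x hx hxK
  rw [dist_eq_norm]
  refine lt_of_le_of_lt (norm_le_of (C := ε / 2) (by positivity) fun y => ?_) (by linarith)
  rw [ZeroAtInftyContinuousMap.sub_apply, hΦ, hΦ]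
  by_cases hy : y ∈ K
  · have := hxK y hy
    rw [dist_comm, dist_eq_norm] at this
    exact this.le
  · calc ‖F (x, y) - F (x₀, y)‖ ≤ ‖F (x, y)‖ + ‖F (x₀, y)‖ := norm_sub_le _ _
      _ ≤ ε / 2 := by linarith [hx y hy, hKF.self_of_nhds y hy]

theorem exists_compact_of_zeroAtInfty (f : C₀(X, ℂ)) {ε : ℝ} (hε : 0 < ε) :
    ∃ K : Set X, IsCompact K ∧ ∀ x ∉ K, ‖f x‖ ≤ ε := by
  have hev : ∀ᶠ y in cocompact X, ‖f y‖ < ε := by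
    simpa using (ZeroAtInftyContinuousMapClass.zero_at_infty f).eventually
      (Metric.ball_mem_nhds (0 : ℂ) hε)
  obtain ⟨K, hK, hKF⟩ := mem_cocompact.1 hev
  exact ⟨K, hK, fun x hx => le_of_lt (hKF hx)⟩

/-- The inclusion of the algebraic tensor product `C₀(X) ⊗ C₀(Y)` into `C₀(X × Y)`. -/
def incl : C₀(X, ℂ) ⊗[ℂ] C₀(Y, ℂ) →ₗ[ℂ] C₀(X × Y, ℂ) :=
  TensorProduct.lift
    (LinearMap.mk₂ ℂ tmul
      (fun f f' g => by ext p; simp [add_mul])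
      (fun c f g => by ext p; simp [mul_assoc])
      (fun f g g' => by ext p; simp [mul_add])
      (fun c f g => by ext p; simp [mul_left_comm]))

@[simp] theorem incl_tmul (f : C₀(X, ℂ)) (g : C₀(Y, ℂ)) : incl (f ⊗ₜ[ℂ] g) = tmul f g := by
  simp [incl]

theorem sum_apply {ι : Type*} (s : Finset ι) (f : ι → C₀(X, ℂ)) (x : X) :
    (∑ j ∈ s, f j) x = ∑ j ∈ s, f j x := by
  exact map_sum (dirac x) f s

/-- The bilinear pairing `(f ⊗ g, μ) ↦ ⟨θ((f ⊗ id) μ), g⟩` on the algebraic tensor product. -/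
def pairing (θ : M Y →L[ℂ] M Z) (μ : M (X × Y)) : C₀(X, ℂ) ⊗[ℂ] C₀(Z, ℂ) →ₗ[ℂ] ℂ :=
  TensorProduct.lift
    (LinearMap.mk₂ ℂ (fun f g => θ (slice f μ) g)
      (fun f f' g => by simp [slice_add_left])
      (fun c f g => by simp [slice_smul_left])
      (fun f g g' => by simp)
      (fun c f g => by simp))

@[simp] theorem pairing_tmul (θ : M Y →L[ℂ] M Z) (μ : M (X × Y)) (f : C₀(X, ℂ))
    (g : C₀(Z, ℂ)) : pairing θ μ (f ⊗ₜ[ℂ] g) = θ (slice f μ) g := by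
  simp [pairing]

theorem norm_slice_le (f : C₀(X, ℂ)) (μ : M (X × Y)) : ‖slice f μ‖ ≤ ‖μ‖ * ‖f‖ := by
  refine ContinuousLinearMap.opNorm_le_bound _ (by positivity) fun g => ?_
  rw [slice_apply, mul_assoc]
  refine (μ.le_opNorm _).trans (mul_le_mul_of_nonneg_left ?_ (norm_nonneg μ))
  refine norm_le_of (by positivity) fun p => ?_
  rw [tmul_apply, norm_mul]
  exact mul_le_mul (norm_apply_le f _) (norm_apply_le g _) (norm_nonneg _) (norm_nonneg _)

/-- The flip `M(X × Y) → M(Y × X)`. -/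
def swap : M (X × Y) →L[ℂ] M (Y × X) :=
  pushforward (Homeomorph.prodComm X Y).toCocompactMap

theorem swap_tmul (μ : M (X × Y)) (f : C₀(Y, ℂ)) (g : C₀(X, ℂ)) :
    swap μ (tmul f g) = μ (tmul g f) := by
  refine congrArg μ ?_
  ext p
  exact mul_comm _ _

end Basic

section Partial

variable {X Y : Type*} [TopologicalSpace X] [T2Space X] [TopologicalSpace Y] [T2Space Y]

/-- The partial function `F(x, ·) ∈ C₀(Y)` of `F ∈ C₀(X × Y)`. -/
def partialFun (F : C₀(X × Y, ℂ)) (x : X) : C₀(Y, ℂ) where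
  toFun y := F (x, y)
  continuous_toFun := by fun_prop
  zero_at_infty' := by
    refine (ZeroAtInftyContinuousMapClass.zero_at_infty F).comp
      (CocompactMap.tendsto_of_forall_preimage fun s hs => ?_)
    exact (hs.image continuous_snd).of_isClosed_subset
      (hs.isClosed.preimage (by fun_prop)) fun y hy => ⟨(x, y), hy, rfl⟩

@[simp] theorem partialFun_apply (F : C₀(X × Y, ℂ)) (x : X) (y : Y) :
    partialFun F x y = F (x, y) := rfl

theorem continuous_partialFun (F : C₀(X × Y, ℂ)) : Continuous (partialFun F) := by
  refine continuous_of_locally_uniform F.toContinuousMap _ (fun _ _ => rfl) fun x₀ ε hε => ?_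
  obtain ⟨K, hK, hKF⟩ := exists_compact_of_zeroAtInfty F hε
  exact ⟨Prod.snd '' K, hK.image continuous_snd, Eventually.of_forall fun x y hy =>
    hKF _ fun hxy => hy ⟨_, hxy, rfl⟩⟩

theorem tendsto_partialFun (F : C₀(X × Y, ℂ)) :
    Tendsto (partialFun F) (cocompact X) (𝓝 0) := by
  rw [Metric.tendsto_nhds]
  intro ε hε
  obtain ⟨K, hK, hKF⟩ := exists_compact_of_zeroAtInfty F (half_pos hε)
  filter_upwards [(hK.image continuous_fst).compl_mem_cocompact] with x hx
  rw [dist_zero_right]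
  refine lt_of_le_of_lt (norm_le_of (half_pos hε).le fun y => ?_) (half_lt_self hε)
  exact hKF _ fun hxy => hx ⟨_, hxy, rfl⟩

end Partial

section Tensor

variable {X Y Z : Type*} [TopologicalSpace X] [T2Space X] [LocallyCompactSpace X]
  [TopologicalSpace Y] [T2Space Y] [LocallyCompactSpace Y]
  [TopologicalSpace Z] [T2Space Z] [LocallyCompactSpace Z]

/-- Partitions of unity: a vector-valued function vanishing at infinity is uniformly close to
`∑ j, e j • F (x j)`, where the `e j` are nonnegative with `∑ j, e j ≤ 1`. -/
theorem exists_partition {E : Type*} [NormedAddCommGroup E] [NormedSpace ℂ E] (F : X → E)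
    (hF : Continuous F) (hF0 : Tendsto F (cocompact X) (𝓝 0)) {ε : ℝ} (hε : 0 < ε) :
    ∃ (n : ℕ) (e : Fin n → C₀(X, ℂ)) (x : Fin n → X),
      (∀ y, ∑ j, ‖e j y‖ ≤ 1) ∧ ∀ y, ‖F y - ∑ j, e j y • F (x j)‖ ≤ ε := by
  have hev : ∀ᶠ y in cocompact X, ‖F y‖ < ε / 2 := by
    simpa using hF0.eventually (Metric.ball_mem_nhds (0 : E) (half_pos hε))
  obtain ⟨K, hK, hKF⟩ := mem_cocompact.1 hev
  have hopen : ∀ x, IsOpen {y | ‖F y - F x‖ < ε / 2} := fun x =>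
    isOpen_lt (by fun_prop) continuous_const
  obtain ⟨t, ht⟩ := hK.elim_finite_subcover (fun x : X => {y | ‖F y - F x‖ < ε / 2}) hopen
    (fun x _ => mem_iUnion.2 ⟨x, by simpa using half_pos hε⟩)
  let x : Fin t.card → X := fun j => (t.equivFin.symm j : X)
  have hcov : K ⊆ ⋃ j, {y | ‖F y - F (x j)‖ < ε / 2} := by
    intro y hy
    obtain ⟨z, hz, hyz⟩ := mem_iUnion₂.1 (ht hy)
    exact mem_iUnion.2 ⟨t.equivFin ⟨z, hz⟩, by simpa [x] using hyz⟩
  obtain ⟨p, hp, hpc⟩ := PartitionOfUnity.exists_isSubordinate_of_locallyFinite_t2space hK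
    (fun j => {y | ‖F y - F (x j)‖ < ε / 2}) (fun j => hopen _) (locallyFinite_of_finite _) hcov
  let e : Fin t.card → C₀(X, ℂ) := fun j =>
    { toFun := fun y => (p j y : ℂ)
      continuous_toFun := by fun_prop
      zero_at_infty' := by
        have : HasCompactSupport fun y => (p j y : ℂ) :=
          (hpc j).comp_left (g := fun r : ℝ => (r : ℂ)) (by simp)
        exact this.is_zero_at_infty }
  have he : ∀ j y, e j y = (p j y : ℂ) := fun _ _ => rfl
  have hne : ∀ j y, ‖e j y‖ = p j y := fun j y => by
    rw [he, Complex.norm_real, Real.norm_of_nonneg (p.nonneg j y)]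
  have hsum : ∀ y, ∑ j, p j y ≤ 1 := fun y => by
    rw [← finsum_eq_sum_of_fintype]
    exact p.sum_le_one y
  refine ⟨t.card, e, x, fun y => by simpa only [hne] using hsum y, fun y => ?_⟩
  have h0 : 0 ≤ ∑ j, p j y := Finset.sum_nonneg fun j _ => p.nonneg j y
  have hsplit : F y - ∑ j, e j y • F (x j)
      = (1 - ((∑ j, p j y : ℝ) : ℂ)) • F y + ∑ j, e j y • (F y - F (x j)) := by
    simp only [he, smul_sub, Finset.sum_sub_distrib, ← Finset.sum_smul, sub_smul, one_smul,
      Complex.ofReal_sum]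
    abel
  rw [hsplit]
  have h1 : ‖(1 - ((∑ j, p j y : ℝ) : ℂ)) • F y‖ ≤ ε / 2 := by
    by_cases hy : y ∈ K
    · have : ∑ j, p j y = 1 := by
        rw [← finsum_eq_sum_of_fintype]
        exact p.sum_eq_one hy
      simpa [this] using (half_pos hε).le
    · have hFy : ‖F y‖ < ε / 2 := hKF hy
      rw [norm_smul, ← Complex.ofReal_one, ← Complex.ofReal_sub, Complex.norm_real,
        Real.norm_of_nonneg (by linarith [hsum y])]
      nlinarith [norm_nonneg (F y), hsum y]
  have h2 : ‖∑ j, e j y • (F y - F (x j))‖ ≤ ε / 2 := by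
    calc ‖∑ j, e j y • (F y - F (x j))‖ ≤ ∑ j, p j y * (ε / 2) := by
          refine norm_sum_le_of_le _ fun j _ => ?_
          rw [norm_smul, hne]
          by_cases hy : p j y = 0
          · simp [hy]
          · have hmem : y ∈ {y | ‖F y - F (x j)‖ < ε / 2} :=
              hp j (subset_tsupport _ (by simpa using hy))
            exact mul_le_mul_of_nonneg_left (le_of_lt hmem) (p.nonneg j y)
      _ = (∑ j, p j y) * (ε / 2) := by rw [Finset.sum_mul]
      _ ≤ 1 * (ε / 2) := by gcongr; exact hsum y
      _ = ε / 2 := one_mul _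
  calc _ ≤ ‖(1 - ((∑ j, p j y : ℝ) : ℂ)) • F y‖ + ‖∑ j, e j y • (F y - F (x j))‖ :=
        norm_add_le _ _
    _ ≤ ε := by linarith

theorem denseRange_incl :
    DenseRange (incl : C₀(X, ℂ) ⊗[ℂ] C₀(Y, ℂ) →ₗ[ℂ] C₀(X × Y, ℂ)) := by
  intro F
  rw [Metric.mem_closure_range_iff]
  intro ε hε
  obtain ⟨n, e, x, he, hF⟩ := exists_partition (partialFun F) (continuous_partialFun F)
    (tendsto_partialFun F) (half_pos hε)
  refine ⟨∑ j, e j ⊗ₜ[ℂ] partialFun F (x j), ?_⟩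
  rw [dist_eq_norm]
  refine lt_of_le_of_lt (norm_le_of (half_pos hε).le fun p => ?_) (half_lt_self hε)
  have := (norm_apply_le _ p.2).trans (hF p.1)
  simpa [sum_apply] using this

/-- The pairing is bounded for the supremum norm on `X × Z`. -/
theorem norm_pairing_le (θ : M Y →L[ℂ] M Z) (μ : M (X × Y)) (z : C₀(X, ℂ) ⊗[ℂ] C₀(Z, ℂ)) :
    ‖pairing θ μ z‖ ≤ ‖θ‖ * ‖μ‖ * ‖incl z‖ := by
  obtain ⟨S, rfl⟩ := TensorProduct.exists_finset z
  refine le_of_forall_pos_le_add fun δ hδ => ?_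
  set B : ℝ := ∑ i ∈ S, ‖θ‖ * ‖μ‖ * ‖i.2‖ with hB
  have hB0 : 0 ≤ B := Finset.sum_nonneg fun i _ => by positivity
  have hε : 0 < δ / (B + 1) := by positivity
  obtain ⟨n, e, x, he, hF⟩ := exists_partition (E := S → ℂ) (fun y i => i.1.1 y)
    (by fun_prop)
    (tendsto_pi_nhds.2 fun i => ZeroAtInftyContinuousMapClass.zero_at_infty i.1.1) hε
  have hf : ∀ i ∈ S, ‖i.1 - ∑ j, i.1 (x j) • e j‖ ≤ δ / (B + 1) := by
    intro i hi
    refine norm_le_of hε.le fun y => ?_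
    have := (norm_le_pi_norm _ (⟨i, hi⟩ : S)).trans (hF y)
    simpa [sum_apply, mul_comm] using this
  have hmain : ‖∑ j, θ (slice (e j) μ) (∑ i ∈ S, i.1 (x j) • i.2)‖
      ≤ ‖θ‖ * ‖μ‖ * ‖incl (∑ i ∈ S, i.1 ⊗ₜ[ℂ] i.2)‖ := by
    have hpart : ∀ j, ‖∑ i ∈ S, i.1 (x j) • i.2‖ ≤ ‖incl (∑ i ∈ S, i.1 ⊗ₜ[ℂ] i.2)‖ := by
      intro j
      refine norm_le_of (norm_nonneg _) fun y => ?_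
      have := norm_apply_le (incl (∑ i ∈ S, i.1 ⊗ₜ[ℂ] i.2)) (x j, y)
      simpa [sum_apply] using this
    calc _ ≤ ∑ j, ‖θ‖ * ‖slice (e j) μ‖ * ‖incl (∑ i ∈ S, i.1 ⊗ₜ[ℂ] i.2)‖ := by
          refine norm_sum_le_of_le _ fun j _ => ?_
          refine (ContinuousLinearMap.le_opNorm _ _).trans ?_
          exact mul_le_mul (θ.le_opNorm _) (hpart j) (norm_nonneg _) (by positivity)
      _ = ‖θ‖ * (∑ j, ‖slice (e j) μ‖) * ‖incl (∑ i ∈ S, i.1 ⊗ₜ[ℂ] i.2)‖ := by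
          rw [Finset.mul_sum, Finset.sum_mul]
      _ ≤ _ := by
          gcongr
          exact sum_norm_slice_le μ e he
  have hdiff : pairing θ μ (∑ i ∈ S, i.1 ⊗ₜ[ℂ] i.2)
      = ∑ i ∈ S, θ (slice (i.1 - ∑ j, i.1 (x j) • e j) μ) i.2
        + ∑ j, θ (slice (e j) μ) (∑ i ∈ S, i.1 (x j) • i.2) := by
    have h1 : ∑ j, θ (slice (e j) μ) (∑ i ∈ S, i.1 (x j) • i.2)
        = ∑ i ∈ S, pairing θ μ ((∑ j, i.1 (x j) • e j) ⊗ₜ[ℂ] i.2) := by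
      simp only [map_sum, map_smul, TensorProduct.sum_tmul, ← TensorProduct.smul_tmul',
        pairing_tmul]
      rw [Finset.sum_comm]
    rw [h1, map_sum, ← Finset.sum_add_distrib]
    refine Finset.sum_congr rfl fun i _ => ?_
    rw [← pairing_tmul, ← map_add, ← TensorProduct.add_tmul, sub_add_cancel]
  have herr : ‖∑ i ∈ S, θ (slice (i.1 - ∑ j, i.1 (x j) • e j) μ) i.2‖ ≤ δ := by
    calc _ ≤ ∑ i ∈ S, (‖θ‖ * ‖μ‖ * ‖i.2‖) * (δ / (B + 1)) := by
          refine norm_sum_le_of_le _ fun i hi => ?_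
          refine (ContinuousLinearMap.le_opNorm _ _).trans ?_
          calc _ ≤ (‖θ‖ * (‖μ‖ * (δ / (B + 1)))) * ‖i.2‖ := by
                gcongr
                refine (θ.le_opNorm _).trans ?_
                gcongr
                refine (norm_slice_le _ μ).trans ?_
                gcongr
                exact hf i hi
            _ = _ := by ring
      _ = B * (δ / (B + 1)) := by rw [← Finset.sum_mul]
      _ ≤ δ := by
          rw [mul_div_assoc', div_le_iff₀ (by positivity)]
          nlinarith
  rw [hdiff]
  exact (norm_add_le _ _).trans (by linarith)

theorem functional_ext {φ ψ : M (X × Y)} (h : ∀ f g, φ (tmul f g) = ψ (tmul f g)) : φ = ψ := by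
  refine ContinuousLinearMap.ext fun F => ?_
  refine congrFun (denseRange_incl.equalizer φ.continuous ψ.continuous (funext fun z => ?_)) F
  obtain ⟨S, rfl⟩ := TensorProduct.exists_finset z
  simp [h]

theorem extend_tmul (θ : M Y →L[ℂ] M Z) (μ : M (X × Y)) (f : C₀(X, ℂ)) (g : C₀(Z, ℂ)) :
    (pairing θ μ).extendOfNorm incl (tmul f g) = θ (slice f μ) g := by
  rw [← incl_tmul, LinearMap.extendOfNorm_eq denseRange_incl ⟨_, norm_pairing_le θ μ⟩,
    pairing_tmul]

/-- `id ⊗ θ : M(X × Y) → M(X × Z)` for a bounded linear map `θ : M(Y) → M(Z)`. It is the unique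
map with `⟨(id ⊗ θ) μ, f ⊗ g⟩ = ⟨θ((f ⊗ id) μ), g⟩`; no weak-star continuity of `θ` is needed. -/
def idTensor (θ : M Y →L[ℂ] M Z) : M (X × Y) →L[ℂ] M (X × Z) :=
  LinearMap.mkContinuous
    { toFun := fun μ => (pairing θ μ).extendOfNorm incl
      map_add' := fun μ ν => functional_ext fun f g => by
        simp [extend_tmul, slice_add_right]
      map_smul' := fun c μ => functional_ext fun f g => by
        simp [extend_tmul, slice_smul_right] } ‖θ‖
    (fun μ => LinearMap.opNorm_extendOfNorm_le denseRange_incl (by positivity)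
      (norm_pairing_le θ μ))

theorem idTensor_tmul (θ : M Y →L[ℂ] M Z) (μ : M (X × Y)) (f : C₀(X, ℂ)) (g : C₀(Z, ℂ)) :
    idTensor θ μ (tmul f g) = θ (slice f μ) g :=
  extend_tmul θ μ f g

/-- `θ ⊗ id : M(X × Y) → M(Z × Y)` for a bounded linear map `θ : M(X) → M(Z)`. -/
def tensorId (θ : M X →L[ℂ] M Z) : M (X × Y) →L[ℂ] M (Z × Y) :=
  swap ∘L idTensor θ ∘L swap

end Tensor

section TensorSquare

variable {X Z : Type*} [TopologicalSpace X] [T2Space X] [LocallyCompactSpace X]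
  [TopologicalSpace Z] [T2Space Z] [LocallyCompactSpace Z]

/-- `θ ⊗ θ = (θ ⊗ id)(id ⊗ θ) : M(X × X) → M(Z × Z)` for a bounded linear map `θ`. -/
def tensorSquare (θ : M X →L[ℂ] M Z) : M (X × X) →L[ℂ] M (Z × Z) :=
  tensorId θ ∘L idTensor θ

/-- The bilinear form `(f, g) ↦ ⟨μ, f ⊗ g⟩` of `μ ∈ M(X × X)`, extended to `M(X)'`:
`Ψ ∈ M(X)'` sends it to the measure `f ↦ Ψ((f ⊗ id) μ)` in `M(X)`. -/
def sliceDual (Ψ : StrongDual ℂ (M X)) (μ : M (X × X)) : M X :=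
  LinearMap.mkContinuous
    { toFun := fun f => Ψ (slice f μ)
      map_add' := fun f f' => by rw [slice_add_left, map_add]
      map_smul' := fun c f => by rw [slice_smul_left, map_smul]; rfl } (‖Ψ‖ * ‖μ‖)
    (fun f => by
      rw [mul_assoc]
      exact (Ψ.le_opNorm _).trans
        (mul_le_mul_of_nonneg_left (norm_slice_le f μ) (norm_nonneg Ψ)))

/-- The adjoint `θ' : M(Z)' → M(X)'` at `g ∈ C₀(Z) ⊆ M(Z)'`: the functional `λ ↦ ⟨θ(λ), g⟩`. -/
def adjointAt (θ : M X →L[ℂ] M Z) (g : C₀(Z, ℂ)) : StrongDual ℂ (M X) :=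
  (ContinuousLinearMap.apply ℂ ℂ g) ∘L θ

/-- The duality formula `⟨(θ ⊗ θ) μ, f ⊗ g⟩ = ⟨θ'(f) ⊗ θ'(g), μ⟩`. -/
theorem tensorSquare_tmul (θ : M X →L[ℂ] M Z) (μ : M (X × X)) (f g : C₀(Z, ℂ)) :
    tensorSquare θ μ (tmul f g) = adjointAt θ f (sliceDual (adjointAt θ g) μ) := by
  change swap (idTensor θ (swap (idTensor θ μ))) (tmul f g) = _
  rw [swap_tmul, idTensor_tmul]
  have : slice g (swap (idTensor θ μ)) = sliceDual (adjointAt θ g) μ := by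
    refine ContinuousLinearMap.ext fun h => ?_
    rw [slice_apply, swap_tmul, idTensor_tmul]
    rfl
  rw [this]
  rfl

/-- The diagonal `s ↦ (s, s)`, a proper map. -/
def diag (X : Type*) [TopologicalSpace X] [T2Space X] : CocompactMap X (X × X) where
  toFun s := (s, s)
  continuous_toFun := by fun_prop
  cocompact_tendsto' := CocompactMap.tendsto_of_forall_preimage fun s hs =>
    (hs.image continuous_fst).of_isClosed_subset (hs.isClosed.preimage (by fun_prop))
      fun x hx => ⟨(x, x), hx, rfl⟩

/-- The coassociative product `Γ : M(X) → M(X × X)`, `⟨Γ(μ), f⟩ = ∫ f(s, s) dμ(s)`. -/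
def Γ (X : Type*) [TopologicalSpace X] [T2Space X] : M X →L[ℂ] M (X × X) :=
  pushforward (diag X)

end TensorSquare

section Convolution

/-- Tightness: `λ ∈ M(Y)` is concentrated on a compact set up to `ε`. -/
theorem exists_compact_tight {Y : Type*} [TopologicalSpace Y] [T2Space Y]
    [LocallyCompactSpace Y] (ν : M Y) {ε : ℝ} (hε : 0 < ε) :
    ∃ K : Set Y, IsCompact K ∧ ∀ (f : C₀(Y, ℂ)) (c : ℝ), 0 ≤ c → (∀ y ∈ K, ‖f y‖ ≤ c) →
      ‖ν f‖ ≤ ‖ν‖ * c + ε * ‖f‖ := by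
  set δ : ℝ := ε / (1 + ‖ν‖) with hδ
  have hδ0 : 0 < δ := by positivity
  obtain ⟨f₀, hf₀, r, hr, hlt⟩ := exists_near_norm ν hδ0
  obtain ⟨K, hK, hKf⟩ := exists_compact_of_zeroAtInfty f₀ hδ0
  obtain ⟨e, he1, -, hec, he01⟩ := exists_continuous_one_zero_of_isCompact hK
    isClosed_empty (disjoint_empty K)
  refine ⟨tsupport e, hec, fun f c hc hf => ?_⟩
  let g : C₀(Y, ℂ) :=
    { toFun := fun y => (e y : ℂ) * f y
      continuous_toFun := by fun_prop
      zero_at_infty' := by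
        refine isBoundedUnder_le_mul_tendsto_zero (isBoundedUnder_of ⟨1, fun y => ?_⟩)
          (ZeroAtInftyContinuousMapClass.zero_at_infty f)
        have := he01 y
        simp only [Function.comp, Complex.norm_real, Real.norm_eq_abs]
        exact abs_le.2 ⟨by linarith [this.1], this.2⟩ }
  have hg : ∀ y, g y = (e y : ℂ) * f y := fun _ => rfl
  have hgn : ‖g‖ ≤ c := by
    refine norm_le_of hc fun y => ?_
    rw [hg, norm_mul, Complex.norm_real, Real.norm_of_nonneg (he01 y).1]
    by_cases hy : y ∈ tsupport e
    · exact (mul_le_of_le_one_left (norm_nonneg _) (he01 y).2).trans (hf y hy)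
    · simpa [image_eq_zero_of_notMem_tsupport hy] using hc
  have hrest : ‖ν (f - g)‖ ≤ ε * ‖f‖ := by
    obtain ⟨u, hu, hur⟩ := Complex.exists_norm_eq_mul_self (ν (f - g))
    have hnorm : ‖(‖f‖ : ℂ) • f₀ + u • (f - g)‖ ≤ (1 + δ) * ‖f‖ := by
      refine norm_le_of (by positivity) fun y => ?_
      have hv : ((‖f‖ : ℂ) • f₀ + u • (f - g)) y
          = (‖f‖ : ℂ) * f₀ y + u * (((1 - e y : ℝ) : ℂ) * f y) := by
        simp only [ZeroAtInftyContinuousMap.add_apply, ZeroAtInftyContinuousMap.smul_apply,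
          ZeroAtInftyContinuousMap.sub_apply, hg, smul_eq_mul, Complex.ofReal_sub,
          Complex.ofReal_one]
        ring
      rw [hv]
      refine (norm_add_le _ _).trans ?_
      rw [norm_mul, norm_mul, norm_mul, hu, one_mul, Complex.norm_real, norm_norm,
        Complex.norm_real, Real.norm_of_nonneg (by linarith [(he01 y).2])]
      by_cases hy : y ∈ K
      · have h1 : e y = 1 := he1 hy
        have h2 : ‖f₀ y‖ ≤ 1 := (norm_apply_le _ _).trans hf₀
        rw [h1]
        nlinarith [norm_nonneg f]
      · have h1 := hKf y hy
        have h2 := norm_apply_le f y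
        nlinarith [norm_nonneg f, norm_nonneg (f y), (he01 y).1, (he01 y).2]
    have hval : ν ((‖f‖ : ℂ) • f₀ + u • (f - g))
        = ((‖f‖ * r + ‖ν (f - g)‖ : ℝ) : ℂ) := by
      rw [map_add, map_smul, map_smul, hr, smul_eq_mul, smul_eq_mul, ← hur]
      push_cast
      rfl
    have h1 : ‖f‖ * r + ‖ν (f - g)‖ ≤ ‖ν‖ * ((1 + δ) * ‖f‖) := by
      calc ‖f‖ * r + ‖ν (f - g)‖ ≤ ‖((‖f‖ * r + ‖ν (f - g)‖ : ℝ) : ℂ)‖ := by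
            rw [Complex.norm_real]; exact le_abs_self _
        _ = ‖ν ((‖f‖ : ℂ) • f₀ + u • (f - g))‖ := by rw [hval]
        _ ≤ _ := (ν.le_opNorm _).trans (mul_le_mul_of_nonneg_left hnorm (norm_nonneg ν))
    have h2 : δ * (1 + ‖ν‖) = ε := by rw [hδ]; field_simp
    have h3 : (‖ν‖ - δ) * ‖f‖ ≤ r * ‖f‖ := mul_le_mul_of_nonneg_right hlt.le (norm_nonneg f)
    have h4 : ε * ‖f‖ = δ * ‖f‖ + ‖ν‖ * δ * ‖f‖ := by rw [← h2]; ring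
    linarith
  calc ‖ν f‖ = ‖ν g + ν (f - g)‖ := by rw [← map_add, add_sub_cancel]
    _ ≤ ‖ν g‖ + ‖ν (f - g)‖ := norm_add_le _ _
    _ ≤ ‖ν‖ * c + ε * ‖f‖ :=
        add_le_add ((ν.le_opNorm _).trans (mul_le_mul_of_nonneg_left hgn (norm_nonneg ν))) hrest

variable {G : Type*} [TopologicalSpace G] [Group G] [IsTopologicalGroup G]

/-- The translate `t ↦ f(st)`. -/
def translate (f : C₀(G, ℂ)) (s : G) : C₀(G, ℂ) := f.comp (Homeomorph.mulLeft s).toCocompactMap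

@[simp] theorem translate_apply (f : C₀(G, ℂ)) (s t : G) : translate f s t = f (s * t) := rfl

variable [LocallyCompactSpace G]

theorem continuous_translate (f : C₀(G, ℂ)) : Continuous (translate f) := by
  refine continuous_of_locally_uniform ⟨fun p => f (p.1 * p.2), by fun_prop⟩ _
    (fun _ _ => rfl) fun s₀ ε hε => ?_
  obtain ⟨K, hK, hKf⟩ := exists_compact_of_zeroAtInfty f hε
  obtain ⟨V, hV, hVs⟩ := exists_compact_mem_nhds s₀
  refine ⟨(fun p : G × G => p.1⁻¹ * p.2) '' (V ×ˢ K), (hV.prod hK).image (by fun_prop), ?_⟩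
  filter_upwards [hVs] with s hs t ht
  exact hKf _ fun hst => ht ⟨(s, s * t), ⟨hs, hst⟩, by simp⟩

variable [T2Space G]

/-- The function `s ↦ ∫ f(st) dν(t)`, which lies in `C₀(G)`. -/
def integrateRight (ν : M G) (f : C₀(G, ℂ)) : C₀(G, ℂ) where
  toFun s := ν (translate f s)
  continuous_toFun := ν.continuous.comp (continuous_translate f)
  zero_at_infty' := by
    rw [Metric.tendsto_nhds]
    intro ε hε
    have hε₁ : 0 < ε / (2 * (1 + ‖f‖)) := by positivity
    have hε₂ : 0 < ε / (2 * (1 + ‖ν‖)) := by positivity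
    obtain ⟨K, hK, hKν⟩ := exists_compact_tight ν hε₁
    obtain ⟨L, hL, hLf⟩ := exists_compact_of_zeroAtInfty f hε₂
    have hc : IsCompact ((fun p : G × G => p.1 * p.2⁻¹) '' (L ×ˢ K)) :=
      (hL.prod hK).image (by fun_prop)
    filter_upwards [hc.compl_mem_cocompact] with s hs
    have h1 := hKν (translate f s) _ hε₂.le fun t ht =>
      hLf (s * t) fun hst => hs ⟨(s * t, t), ⟨hst, ht⟩, by simp⟩
    have h2 : ‖translate f s‖ ≤ ‖f‖ := norm_le_of (norm_nonneg _) fun t => norm_apply_le f _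
    rw [dist_zero_right]
    have h3 : ε / (2 * (1 + ‖f‖)) * ‖translate f s‖ ≤ ε / 2 * (‖f‖ / (1 + ‖f‖)) := by
      calc _ ≤ ε / (2 * (1 + ‖f‖)) * ‖f‖ := by gcongr
        _ = _ := by field_simp
    have h4 : ‖ν‖ * (ε / (2 * (1 + ‖ν‖))) = ε / 2 * (‖ν‖ / (1 + ‖ν‖)) := by field_simp
    have h5 : ‖f‖ / (1 + ‖f‖) < 1 := by
      rw [div_lt_one (by positivity)]; linarith
    have h6 : ‖ν‖ / (1 + ‖ν‖) < 1 := by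
      rw [div_lt_one (by positivity)]; linarith
    nlinarith

@[simp] theorem integrateRight_apply (ν : M G) (f : C₀(G, ℂ)) (s : G) :
    integrateRight ν f s = ν (translate f s) := rfl

theorem norm_integrateRight_le (ν : M G) (f : C₀(G, ℂ)) :
    ‖integrateRight ν f‖ ≤ ‖ν‖ * ‖f‖ := by
  refine norm_le_of (by positivity) fun s => (ν.le_opNorm _).trans ?_
  gcongr
  exact norm_le_of (norm_nonneg _) fun t => norm_apply_le f _

/-- The convolution product `⟨μ * ν, f⟩ = ∫∫ f(st) dν(t) dμ(s)` on `M(G)`. -/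
def conv (μ ν : M G) : M G :=
  LinearMap.mkContinuous
    { toFun := fun f => μ (integrateRight ν f)
      map_add' := fun f g => by
        rw [← map_add]
        refine congrArg μ ?_
        ext s
        exact map_add ν (translate f s) (translate g s)
      map_smul' := fun c f => by
        rw [RingHom.id_apply, ← map_smul]
        refine congrArg μ ?_
        ext s
        exact map_smul ν c (translate f s) } (‖μ‖ * ‖ν‖)
    (fun f => by
      rw [mul_assoc]
      exact (μ.le_opNorm _).trans
        (mul_le_mul_of_nonneg_left (norm_integrateRight_le ν f) (norm_nonneg μ)))

theorem conv_apply (μ ν : M G) (f : C₀(G, ℂ)) : conv μ ν f = μ (integrateRight ν f) := rfl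

theorem norm_conv_le (μ ν : M G) : ‖conv μ ν‖ ≤ ‖μ‖ * ‖ν‖ :=
  LinearMap.mkContinuous_norm_le _ (by positivity) _

/-- `M(G)` is a unital Banach algebra under convolution, with unit the point mass at `1`. -/
instance : NormedRing (M G) :=
  { (inferInstance : NormedAddCommGroup (M G)) with
    mul := conv
    one := dirac 1
    left_distrib := fun μ ν ρ => ContinuousLinearMap.ext fun f => by
      change μ (integrateRight (ν + ρ) f) = μ (integrateRight ν f) + μ (integrateRight ρ f)
      rw [← map_add]
      rfl
    right_distrib := fun μ ν ρ => rfl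
    zero_mul := fun μ => rfl
    mul_zero := fun μ => ContinuousLinearMap.ext fun f => by
      change μ (integrateRight 0 f) = 0
      rw [← map_zero μ]
      rfl
    mul_assoc := fun μ ν ρ => ContinuousLinearMap.ext fun f => by
      change μ (integrateRight ν (integrateRight ρ f)) = μ (integrateRight (conv ν ρ) f)
      refine congrArg μ ?_
      ext r
      refine congrArg ν ?_
      ext s
      refine congrArg ρ ?_
      ext t
      exact congrArg f (mul_assoc r s t)
    one_mul := fun μ => ContinuousLinearMap.ext fun f => by
      change μ (translate f 1) = μ f
      refine congrArg μ ?_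
      ext t
      exact congrArg f (one_mul t)
    mul_one := fun μ => ContinuousLinearMap.ext fun f => by
      change μ (integrateRight (dirac 1) f) = μ f
      refine congrArg μ ?_
      ext t
      exact congrArg f (mul_one t)
    norm_mul_le := norm_conv_le }

instance : NormedAlgebra ℂ (M G) :=
  { Algebra.ofModule (R := ℂ) (A := M G) (fun c μ ν => rfl)
      (fun c μ ν => ContinuousLinearMap.ext fun f => by
        change μ (integrateRight (c • ν) f) = c • μ (integrateRight ν f)
        rw [← map_smul]
        rfl) with
    norm_smul_le := fun c μ => norm_smul_le c μ }

theorem mul_apply (μ ν : M G) (f : C₀(G, ℂ)) : (μ * ν) f = μ (integrateRight ν f) := rfl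

end Convolution

end MeasureAlgebra

end

/-! The diagonal condition singles out the point masses. Since `Γ` sends the point mass at `x` to
its own tensor square, testing the hypothesis on `f ⊗ g` shows that the image of a point mass is a
multiplicative functional on C₀(H); it is nonzero by injectivity, hence itself a point mass
(`exists_eq_dirac_of_mul`, `exists_map_dirac_eq`). The inverse of `θ` satisfies the same condition
(`tensorSquare_Γ_of_inverse`), so `θ` restricts to a bijection `α` of point masses, which is a group
isomorphism because convolution of point masses is the group law.

It remains to see that `α` is a homeomorphism and that it determines `θ`. Linear combinations of
point masses are only weak-star dense and `θ` is merely norm continuous, so neither is automatic.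
The remedy is to multiply by measures `μ` whose translates `δ_s * μ` depend norm-continuously on
`s`. Haar densities supply enough of them: only `ρ = 0` satisfies `ρ * μ = 0` for all such `μ`
(`eq_zero_of_mul_isTranslationContinuous`). Along `s → 1` the measures `δ_{α(s)} * θ(μ) = θ(δ_s *
μ)` converge in norm to `θ(μ)`, and this forces `α(s) → 1`. Moreover `ν * μ` is a norm limit of
finite combinations of the `δ_s * μ`, so `θ(ν * μ)` can be computed from `α` and equals `α_*(ν) *
θ(μ)`. Cancelling `μ` gives `θ(ν) = α_*(ν)`. This is the adjoint of `f ↦ f ∘ α`, whence weak-star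
continuity. -/

noncomputable section

namespace MeasureAlgebra

/-! ### Characters of C₀(X) and approximation of integrals by finite sums -/

section Functions

variable {X : Type*} [TopologicalSpace X]

/-- The product of a bounded continuous function and a function vanishing at infinity. -/
def mulBounded (b : X → ℂ) (hb : Continuous b) (C : ℝ) (hC : ∀ x, ‖b x‖ ≤ C) (f : C₀(X, ℂ)) :
    C₀(X, ℂ) where
  toFun x := b x * f x
  continuous_toFun := by fun_prop
  zero_at_infty' := isBoundedUnder_le_mul_tendsto_zero (isBoundedUnder_of ⟨C, hC⟩)
    (ZeroAtInftyContinuousMapClass.zero_at_infty f)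

@[simp] theorem mulBounded_apply (b : X → ℂ) (hb : Continuous b) (C : ℝ) (hC : ∀ x, ‖b x‖ ≤ C)
    (f : C₀(X, ℂ)) (x : X) : mulBounded b hb C hC f x = b x * f x := rfl

variable [T2Space X] [LocallyCompactSpace X]

theorem exists_eq_one_eq_zero {s t : X} (h : s ≠ t) : ∃ f : C₀(X, ℂ), f s = 1 ∧ f t = 0 := by
  obtain ⟨e, he1, he0, hec, -⟩ := exists_continuous_one_zero_of_isCompact
    (isCompact_singleton (x := s)) (isClosed_singleton (x := t)) (by simpa using h)
  refine ⟨{ toFun := fun y => (e y : ℂ)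
            continuous_toFun := by fun_prop
            zero_at_infty' := ?_ }, ?_, ?_⟩
  · have : HasCompactSupport fun y => (e y : ℂ) :=
      hec.comp_left (g := fun r : ℝ => (r : ℂ)) (by simp)
    exact this.is_zero_at_infty
  · change (e s : ℂ) = 1
    simpa using he1 (mem_singleton s)
  · change (e t : ℂ) = 0
    simpa using he0 (mem_singleton t)

theorem dirac_injective : Function.Injective (dirac : X → M X) := by
  intro s t hst
  by_contra h
  obtain ⟨f, h1, h0⟩ := exists_eq_one_eq_zero h
  have := DFunLike.congr_fun hst f
  simp [h1, h0] at this

theorem dirac_ne_zero (x : X) : dirac x ≠ 0 := by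
  obtain ⟨e, he1, -, hec, -⟩ := exists_continuous_one_zero_of_isCompact
    (isCompact_singleton (x := x)) isClosed_empty (disjoint_empty _)
  intro h
  have hc : HasCompactSupport fun y => (e y : ℂ) :=
    hec.comp_left (g := fun r : ℝ => (r : ℂ)) (by simp)
  have h2 := DFunLike.congr_fun h
    ({ toFun := fun y => (e y : ℂ)
       continuous_toFun := by fun_prop
       zero_at_infty' := hc.is_zero_at_infty } : C₀(X, ℂ))
  have h3 : (e x : ℂ) = 0 := h2
  have h4 : e x = 1 := he1 (mem_singleton x)
  simp [h4] at h3

/-- A character of `C₀(X)` is the evaluation at a point. -/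
theorem exists_eq_dirac_of_mul {φ : M X} (hφ : φ ≠ 0) (hmul : ∀ f g, φ (f * g) = φ f * φ g) :
    ∃ x, φ = dirac x := by
  obtain ⟨f₀, hf₀⟩ : ∃ f, φ f ≠ 0 := by
    by_contra! h
    exact hφ (ContinuousLinearMap.ext h)
  by_cases hker : ∃ x, ∀ f, φ f = 0 → f x = 0
  -- If the kernel of `φ` lies in that of evaluation at `x`, the two functionals are proportional;
  -- testing on `f₀ * f₀` shows that the factor is 1.
  · obtain ⟨x, hx⟩ := hker
    refine ⟨x, ContinuousLinearMap.ext fun f => ?_⟩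
    have key : ∀ g, φ f₀ * g x = φ g * f₀ x := fun g => by
      have := hx (φ f₀ • g - φ g • f₀) (by simp [mul_comm])
      simpa [sub_eq_zero] using this
    have h1 : φ f₀ * f₀ x * φ f₀ = φ f₀ * f₀ x * f₀ x := by
      have := key (f₀ * f₀)
      rw [hmul, ZeroAtInftyContinuousMap.mul_apply] at this
      linear_combination -this
    by_cases h0 : f₀ x = 0
    · exfalso
      have hz : dirac x = 0 := ContinuousLinearMap.ext fun g => by
        have := key g
        rw [h0, mul_zero] at this
        exact (mul_eq_zero.1 this).resolve_left hf₀
      exact dirac_ne_zero x hz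
    · have h2 : φ f₀ = f₀ x := mul_left_cancel₀ (mul_ne_zero hf₀ h0) h1
      have h3 := key f
      rw [← h2, mul_comm] at h3
      exact (mul_right_cancel₀ hf₀ h3).symm
  -- Otherwise the kernel, an ideal, has no common zero. By compactness it contains a function `h ≥
  -- 0` that is positive on a compact set carrying almost all of `φ`. Then `f₀` agrees on that set
  -- with a multiple of `h`, so `φ f₀` would be too small.
  · exfalso
    push Not at hker
    choose k hk0 hkx using hker
    have hε : 0 < ‖φ f₀‖ / (2 * ‖f₀‖ + 1) := by
      have : 0 < ‖φ f₀‖ := norm_pos_iff.2 hf₀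
      positivity
    obtain ⟨K, hK, hKφ⟩ := exists_compact_tight φ hε
    obtain ⟨T, hT⟩ := hK.elim_finite_subcover (fun x : X => {y | k x y ≠ 0})
      (fun x => isOpen_ne_fun (by fun_prop) continuous_const)
      (fun x _ => mem_iUnion.2 ⟨x, hkx x⟩)
    let h : C₀(X, ℂ) := ∑ t ∈ T, star (k t) * k t
    let r : X → ℝ := fun y => ∑ t ∈ T, ‖k t y‖ ^ 2
    have hr : Continuous r := by fun_prop
    have hr0 : ∀ y, 0 ≤ r y := fun y => by positivity
    have hhr : ∀ y, h y = (r y : ℂ) := fun y => by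
      simp only [h, r, sum_apply, ZeroAtInftyContinuousMap.mul_apply,
        ZeroAtInftyContinuousMap.star_apply, Complex.ofReal_sum, Complex.ofReal_pow]
      refine Finset.sum_congr rfl fun t _ => ?_
      exact Complex.conj_mul' _
    have hφh : φ h = 0 := by
      simp [h, map_sum, hmul, hk0]
    obtain ⟨δ, hδ, hδr⟩ := hK.exists_forall_le' hr.continuousOn (a := 0) (fun y hy => by
      obtain ⟨t, ht, hty⟩ := mem_iUnion₂.1 (hT hy)
      have : 0 < ‖k t y‖ ^ 2 := by
        have := norm_pos_iff.2 hty
        positivity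
      exact this.trans_le (Finset.single_le_sum (f := fun t => ‖k t y‖ ^ 2)
        (fun _ _ => by positivity) ht))
    have hm0 : ∀ y, 0 < max (r y) δ := fun y => lt_max_of_lt_right hδ
    -- Truncating the denominator at `δ` keeps `w` in C₀(X); since `h ≥ δ` on `K`, still `w * h =
    -- f₀` there, and `f₀ - w * h` is `f₀` times a factor in [0, 1].
    let w := mulBounded (fun y => (((max (r y) δ)⁻¹ : ℝ) : ℂ))
      (Complex.continuous_ofReal.comp
        ((hr.max continuous_const).inv₀ fun y => (hm0 y).ne')) δ⁻¹
      (fun y => by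
        rw [Complex.norm_real, Real.norm_of_nonneg (inv_nonneg.2 (hm0 y).le)]
        exact inv_anti₀ hδ (le_max_right _ _)) f₀
    have hval : ∀ y, (f₀ - w * h) y = ((1 - (max (r y) δ)⁻¹ * r y : ℝ) : ℂ) * f₀ y := fun y => by
      simp only [ZeroAtInftyContinuousMap.sub_apply, ZeroAtInftyContinuousMap.mul_apply, hhr, w,
        mulBounded_apply]
      push_cast
      ring
    have hle : ‖f₀ - w * h‖ ≤ ‖f₀‖ := by
      refine norm_le_of (norm_nonneg _) fun y => ?_
      have h1 : (max (r y) δ)⁻¹ * r y ≤ 1 := by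
        rw [inv_mul_le_iff₀ (hm0 y), mul_one]
        exact le_max_left _ _
      have h2 : 0 ≤ (max (r y) δ)⁻¹ * r y := mul_nonneg (inv_nonneg.2 (hm0 y).le) (hr0 y)
      rw [hval, norm_mul, Complex.norm_real, Real.norm_of_nonneg (by linarith)]
      exact (mul_le_of_le_one_left (norm_nonneg _) (by linarith)).trans (norm_apply_le _ _)
    have h1 := hKφ (f₀ - w * h) 0 le_rfl (fun y hy => by
      rw [hval, max_eq_left (hδr y hy), inv_mul_cancel₀ (hδ.trans_le (hδr y hy)).ne']
      simp)
    rw [map_sub, hmul, hφh, mul_zero, sub_zero, mul_zero, zero_add] at h1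
    have h2 : ‖φ f₀‖ / (2 * ‖f₀‖ + 1) * ‖f₀ - w * h‖ ≤ ‖φ f₀‖ / (2 * ‖f₀‖ + 1) * ‖f₀‖ := by
      gcongr
    have h3 : ‖φ f₀‖ / (2 * ‖f₀‖ + 1) * (2 * ‖f₀‖ + 1) = ‖φ f₀‖ := by field_simp
    nlinarith [norm_nonneg f₀]

/-- A measure integrates bounded continuous vector-valued functions approximately by finite
combinations of their values, uniformly over bounded sets of functionals. -/
theorem exists_sum_approx {E : Type*} [NormedAddCommGroup E] [NormedSpace ℂ E] (ν : M X)
    {F : X → E} (hF : Continuous F) {C : ℝ} (hC : 0 ≤ C) (hFC : ∀ x, ‖F x‖ ≤ C) {ε : ℝ}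
    (hε : 0 < ε) :
    ∃ (n : ℕ) (c : Fin n → ℂ) (x : Fin n → X), ∀ (φ : StrongDual ℂ E) (g : C₀(X, ℂ)),
      (∀ y, g y = φ (F y)) → ‖ν g - φ (∑ j, c j • F (x j))‖ ≤ ε * ‖φ‖ := by
  have hη : 0 < ε / (‖ν‖ + C + 1) := by positivity
  set η := ε / (‖ν‖ + C + 1) with hηdef
  obtain ⟨K, hK, hKν⟩ := exists_compact_tight ν hη
  obtain ⟨e, he1, -, hec, he01⟩ := exists_continuous_one_zero_of_isCompact hK
    isClosed_empty (disjoint_empty K)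
  have hec' : HasCompactSupport fun y => (e y : ℂ) • F y :=
    (hec.comp_left (g := fun r : ℝ => (r : ℂ)) (by simp)).smul_right
  obtain ⟨n, p, x, -, hpF⟩ := exists_partition (fun y => (e y : ℂ) • F y) (by fun_prop)
    hec'.is_zero_at_infty hη
  -- These are the coefficients of the Riemann sum for the cut-off integrand `e • F`. They are fixed
  -- before `φ` and `g`, which gives the uniformity.
  refine ⟨n, fun j => ν (p j) * e (x j), x, fun φ g hg => ?_⟩
  have hen : ∀ y, ‖((e y : ℝ) : ℂ)‖ ≤ 1 := fun y => by
    rw [Complex.norm_real, Real.norm_of_nonneg (he01 y).1]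
    exact (he01 y).2
  let g₁ := mulBounded (fun y => (e y : ℂ)) (by fun_prop) 1 hen g
  have hgn : ‖g‖ ≤ C * ‖φ‖ := norm_le_of (by positivity) fun y => by
    rw [hg, mul_comm]
    exact (φ.le_opNorm _).trans (by gcongr; exact hFC y)
  have hout : ‖ν (g - g₁)‖ ≤ η * (C * ‖φ‖) := by
    have hv : ∀ y, (g - g₁) y = ((1 - e y : ℝ) : ℂ) * g y := fun y => by
      simp [g₁, sub_mul]
    have h1 := hKν (g - g₁) 0 le_rfl (fun y hy => by
      have h : e y = 1 := he1 hy
      rw [hv, h]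
      simp)
    rw [mul_zero, zero_add] at h1
    refine h1.trans ?_
    gcongr
    refine (norm_le_of (norm_nonneg _) fun y => ?_).trans hgn
    rw [hv, norm_mul, Complex.norm_real, Real.norm_of_nonneg (by linarith [(he01 y).2])]
    exact (mul_le_of_le_one_left (norm_nonneg _) (by linarith [(he01 y).1])).trans
      (norm_apply_le _ _)
  have hin : ‖ν (g₁ - ∑ j, ((e (x j) : ℂ) * φ (F (x j))) • p j)‖ ≤ ‖ν‖ * (‖φ‖ * η) := by
    refine (ν.le_opNorm _).trans ?_
    gcongr
    refine norm_le_of (by positivity) fun y => ?_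
    have h1 : (g₁ - ∑ j, ((e (x j) : ℂ) * φ (F (x j))) • p j) y
        = φ ((e y : ℂ) • F y - ∑ j, p j y • (e (x j) : ℂ) • F (x j)) := by
      simp [g₁, sum_apply, hg, mul_comm]
    rw [h1]
    exact (φ.le_opNorm _).trans (by gcongr; exact hpF y)
  have hsplit : ν g - φ (∑ j, (ν (p j) * e (x j)) • F (x j))
      = ν (g - g₁) + ν (g₁ - ∑ j, ((e (x j) : ℂ) * φ (F (x j))) • p j) := by
    rw [← map_add, sub_add_sub_cancel, map_sub, map_sum, map_sum]
    congr 1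
    refine Finset.sum_congr rfl fun j _ => ?_
    simp only [map_smul, smul_eq_mul]
    ring
  rw [hsplit]
  refine (norm_add_le _ _).trans ((add_le_add hout hin).trans ?_)
  have h1 : η * (‖ν‖ + C + 1) = ε := by rw [hηdef]; field_simp
  have h2 : 0 ≤ η * ‖φ‖ := by positivity
  calc η * (C * ‖φ‖) + ‖ν‖ * (‖φ‖ * η) ≤ η * (‖ν‖ + C + 1) * ‖φ‖ := by linarith
    _ = ε * ‖φ‖ := by rw [h1]

end Functions

/-! ### Diagonal maps and point masses -/

section Diagonal

variable {X Y Z : Type*} [TopologicalSpace X] [T2Space X] [LocallyCompactSpace X]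
  [TopologicalSpace Y] [T2Space Y] [LocallyCompactSpace Y]
  [TopologicalSpace Z] [T2Space Z] [LocallyCompactSpace Z]

/-- Slicing in the first variable turns `id ⊗ θ` into `θ`, so the cancellation can be checked slice
by slice. -/
theorem idTensor_idTensor {θ : M Y →L[ℂ] M Z} {ψ : M Z →L[ℂ] M Y} (h : ∀ μ, ψ (θ μ) = μ)
    (μ : M (X × Y)) : idTensor ψ (idTensor θ μ) = μ := by
  refine functional_ext fun f g => ?_
  have : slice f (idTensor θ μ) = θ (slice f μ) :=
    ContinuousLinearMap.ext fun k => idTensor_tmul θ μ f k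
  rw [idTensor_tmul, this, h]
  rfl

omit [T2Space X] [LocallyCompactSpace X] [T2Space Y] [LocallyCompactSpace Y] in
theorem swap_swap (μ : M (X × Y)) : swap (swap μ) = μ := rfl

omit [LocallyCompactSpace X] in
theorem swap_Γ (μ : M X) : swap (Γ X μ) = Γ X μ := rfl

/-- The inverse has to be peeled off one leg at a time, and the two legs need not commute when `θ`
is not weak-star continuous. As `Γ` is invariant under the flip, the hypothesis also holds with the
outer leg exchanged, and the factors then cancel in the right order. -/
theorem tensorSquare_Γ_of_inverse {θ : M X →L[ℂ] M Z} {ψ : M Z →L[ℂ] M X}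
    (hψ : ∀ μ, ψ (θ μ) = μ) (hθ : ∀ μ, tensorSquare θ (Γ X μ) = Γ Z (θ μ)) (μ : M X) :
    tensorSquare ψ (Γ Z (θ μ)) = Γ X (ψ (θ μ)) := by
  have h1 : swap (idTensor θ (swap (idTensor θ (Γ X μ)))) = Γ Z (θ μ) := hθ μ
  have h2 : idTensor θ (swap (idTensor θ (Γ X μ))) = Γ Z (θ μ) :=
    (congrArg swap h1).trans (swap_Γ _)
  change swap (idTensor ψ (swap (idTensor ψ (Γ Z (θ μ))))) = _
  rw [← h2, idTensor_idTensor hψ, swap_swap, idTensor_idTensor hψ, swap_Γ, hψ]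

/-- An injective map compatible with the diagonals carries point masses to point masses. -/
theorem exists_map_dirac_eq {θ : M X →L[ℂ] M Z} (hinj : Function.Injective θ)
    (hθ : ∀ μ, tensorSquare θ (Γ X μ) = Γ Z (θ μ)) (x : X) : ∃ z, θ (dirac x) = dirac z := by
  refine exists_eq_dirac_of_mul (fun h => dirac_ne_zero x (hinj (h.trans (map_zero θ).symm)))
    fun f g => ?_
  have h1 := DFunLike.congr_fun (hθ (dirac x)) (tmul f g)
  rw [tensorSquare_tmul] at h1
  -- The image of a point mass under `Γ` is an elementary tensor, so its slice by any functional on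
  -- `M X`, weak-star continuous or not, is a multiple of that point mass.
  have h2 : sliceDual (adjointAt θ g) (Γ X (dirac x)) = θ (dirac x) g • dirac x := by
    refine ContinuousLinearMap.ext fun k => ?_
    have h3 : slice k (Γ X (dirac x)) = k x • dirac x := rfl
    change θ (slice k (Γ X (dirac x))) g = θ (dirac x) g * k x
    rw [h3, map_smul]
    exact mul_comm _ _
  rw [h2, map_smul] at h1
  calc θ (dirac x) (f * g) = Γ Z (θ (dirac x)) (tmul f g) := rfl
    _ = θ (dirac x) g * θ (dirac x) f := h1.symm
    _ = _ := mul_comm _ _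

end Diagonal

/-! ### Measures with continuous compactly supported density -/

section Density

open MeasureTheory

variable {X : Type*} [TopologicalSpace X] [MeasurableSpace X] [BorelSpace X]

/-- The measure `h dm` with a continuous compactly supported density `h`. -/
def density (m : Measure X) [IsFiniteMeasureOnCompacts m] (h : X → ℝ) (hc : Continuous h)
    (hs : HasCompactSupport h) : M X :=
  LinearMap.mkContinuous
    { toFun := fun f => ∫ t, h t • f t ∂m
      map_add' := fun f g => by
        rw [← integral_add]
        · simp
        · exact (hc.smul (map_continuous f)).integrable_of_hasCompactSupport hs.smul_right
        · exact (hc.smul (map_continuous g)).integrable_of_hasCompactSupport hs.smul_right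
      map_smul' := fun c f => by
        rw [RingHom.id_apply, ← integral_smul]
        refine integral_congr_ae (.of_forall fun t => ?_)
        exact smul_comm (h t) c (f t) } (∫ t, ‖h t‖ ∂m)
    (fun f => by
      rw [← integral_mul_const]
      refine norm_integral_le_of_norm_le
        ((hc.integrable_of_hasCompactSupport hs).norm.mul_const _) (.of_forall fun t => ?_)
      rw [norm_smul]
      gcongr
      exact norm_apply_le f t)

variable (m : Measure X) [IsFiniteMeasureOnCompacts m]

theorem density_apply (h : X → ℝ) (hc : Continuous h) (hs : HasCompactSupport h)
    (f : C₀(X, ℂ)) : density m h hc hs f = ∫ t, h t • f t ∂m := rfl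

/-- Reduces norm continuity of translation in `M X` to L¹ continuity of the densities. -/
theorem norm_density_sub_le {h k : X → ℝ} (hc : Continuous h) (hs : HasCompactSupport h)
    (kc : Continuous k) (ks : HasCompactSupport k) :
    ‖density m h hc hs - density m k kc ks‖ ≤ ∫ t, ‖h t - k t‖ ∂m := by
  refine ContinuousLinearMap.opNorm_le_bound _ (integral_nonneg fun _ => norm_nonneg _)
    fun f => ?_
  rw [sub_apply, density_apply, density_apply, ← integral_sub
    (f := fun t => h t • f t) (g := fun t => k t • f t)
    ((hc.smul (map_continuous f)).integrable_of_hasCompactSupport hs.smul_right)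
    ((kc.smul (map_continuous f)).integrable_of_hasCompactSupport ks.smul_right),
    ← integral_mul_const]
  refine norm_integral_le_of_norm_le
    (((hc.integrable_of_hasCompactSupport hs).sub
      (kc.integrable_of_hasCompactSupport ks)).norm.mul_const _) (.of_forall fun t => ?_)
  rw [← sub_smul, norm_smul]
  gcongr
  exact norm_apply_le f t

end Density

/-! ### Measures with norm-continuous translates -/

section Group

variable {G : Type*} [TopologicalSpace G] [Group G] [IsTopologicalGroup G]
  [LocallyCompactSpace G] [T2Space G]

theorem dirac_mul_apply (s : G) (μ : M G) (f : C₀(G, ℂ)) :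
    (dirac s * μ) f = integrateRight μ f s := rfl

theorem dirac_mul_dirac (s t : G) : (dirac s * dirac t : M G) = dirac (s * t) := rfl

theorem dirac_one : (dirac 1 : M G) = 1 := rfl

theorem norm_dirac_mul_le (s : G) (μ : M G) : ‖dirac s * μ‖ ≤ ‖μ‖ := by
  refine ContinuousLinearMap.opNorm_le_bound _ (norm_nonneg _) fun f => ?_
  refine (μ.le_opNorm _).trans ?_
  gcongr
  exact norm_le_of (norm_nonneg _) fun t => norm_apply_le f _

omit [T2Space G] in
/-- Functions in `C₀(G)` are uniformly continuous for right translations. -/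
theorem eventually_norm_apply_mul_sub_le (f : C₀(G, ℂ)) {ε : ℝ} (hε : 0 < ε) :
    ∀ᶠ t in 𝓝 (1 : G), ∀ s, ‖f (s * t) - f s‖ ≤ ε := by
  -- Inversion turns right translates into left ones, to which `continuous_translate` applies.
  let k : C₀(G, ℂ) := f.comp (Homeomorph.inv G).toCocompactMap
  have hk : ∀ t, k t = f t⁻¹ := fun _ => rfl
  have h : Tendsto (fun t : G => translate k t⁻¹) (𝓝 1) (𝓝 (translate k 1)) := by
    have := ((continuous_translate k).comp continuous_inv).tendsto (1 : G)
    simpa only [inv_one, Function.comp_def] using this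
  filter_upwards [(Metric.tendsto_nhds.1 h) ε hε] with t ht s
  rw [dist_eq_norm] at ht
  have := (norm_apply_le _ s⁻¹).trans ht.le
  simpa [hk] using this

/-- The left uniformly continuous measures: those `μ` for which `s ↦ δ_s * μ` is continuous for
the norm. -/
def IsTranslationContinuous (μ : M G) : Prop := Continuous fun s : G => dirac s * μ

open MeasureTheory in
-- By left invariance, translating the measure amounts to translating its density, and translation
-- of a continuous compactly supported function is L¹ continuous.
theorem isTranslationContinuous_density [MeasurableSpace G] [BorelSpace G] (m : Measure G)
    [IsFiniteMeasureOnCompacts m] [m.IsMulLeftInvariant] (h : G → ℝ) (hc : Continuous h)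
    (hs : HasCompactSupport h) : IsTranslationContinuous (density m h hc hs) := by
  have hcs : ∀ s : G, Continuous fun t => h (s⁻¹ * t) := fun s => by fun_prop
  have hss : ∀ s : G, HasCompactSupport fun t => h (s⁻¹ * t) := fun s =>
    hs.comp_homeomorph (Homeomorph.mulLeft s⁻¹)
  have htr : ∀ s : G, dirac s * density m h hc hs = density m _ (hcs s) (hss s) := fun s => by
    refine ContinuousLinearMap.ext fun f => ?_
    change ∫ t, h t • f (s * t) ∂m = ∫ t, h (s⁻¹ * t) • f t ∂m
    rw [← integral_mul_left_eq_self (fun t => h (s⁻¹ * t) • f t) s]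
    simp
  unfold IsTranslationContinuous
  simp only [htr]
  rw [continuous_iff_continuousAt]
  intro s₀
  obtain ⟨V, hV, hVs⟩ := exists_compact_mem_nhds s₀
  -- One compact set containing the supports of all translates by elements of `V`.
  have hk : IsCompact ((fun p : G × G => p.1 * p.2) '' (V ×ˢ tsupport h)) :=
    (hV.prod hs).image (by fun_prop)
  have hcont : ContinuousOn (fun s => ∫ t, ‖h (s⁻¹ * t) - h (s₀⁻¹ * t)‖ ∂m) V := by
    refine continuousOn_integral_of_compact_support hk (by fun_prop) fun s t hsV ht => ?_
    have hz : ∀ r ∈ V, h (r⁻¹ * t) = 0 := fun r hr => by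
      refine image_eq_zero_of_notMem_tsupport fun hmem => ht ?_
      exact ⟨(r, r⁻¹ * t), ⟨hr, hmem⟩, by simp⟩
    rw [hz s hsV, hz s₀ (mem_of_mem_nhds hVs), sub_zero, norm_zero]
  have hlim := (hcont.continuousAt hVs).tendsto
  simp only [sub_self, norm_zero, integral_zero] at hlim
  rw [ContinuousAt, tendsto_iff_norm_sub_tendsto_zero]
  exact squeeze_zero (fun _ => norm_nonneg _)
    (fun s => norm_density_sub_le m (hcs s) (hss s) (hcs s₀) (hss s₀)) hlim

open MeasureTheory in
/-- There are enough measures with norm-continuous translates to separate `M(G)`. -/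
theorem eq_zero_of_mul_isTranslationContinuous {ρ : M G}
    (hρ : ∀ μ : M G, IsTranslationContinuous μ → ρ * μ = 0) : ρ = 0 := by
  let : MeasurableSpace G := borel G
  have : BorelSpace G := ⟨rfl⟩
  let m : Measure G := Measure.haar
  refine ContinuousLinearMap.ext fun f => ?_
  rw [zero_apply, ← norm_eq_zero]
  refine le_antisymm (le_of_forall_pos_le_add fun δ hδ => ?_) (norm_nonneg _)
  have hε : 0 < δ / (‖ρ‖ + 1) := by positivity
  obtain ⟨U, hU, hUo, h1U⟩ := eventually_nhds_iff.1 (eventually_norm_apply_mul_sub_le f hε)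
  -- An unnormalised approximate identity: `h` lives where right translation moves `f` by at most `δ
  -- / (‖ρ‖ + 1)`. Its integral is carried along as a factor and cancelled at the end.
  obtain ⟨h, hh1, hh0, hs, h01⟩ := exists_continuous_one_zero_of_isCompact
    (isCompact_singleton (x := (1 : G))) hUo.isClosed_compl (by simpa using h1U)
  have hc : Continuous h := h.continuous
  have hpos : 0 < ∫ t, h t ∂m := by
    refine hc.integral_pos_of_hasCompactSupport_nonneg_nonzero hs (fun t => (h01 t).1) (x := 1) ?_
    rw [hh1 (mem_singleton _)]
    exact one_ne_zero
  have hint := hc.integrable_of_hasCompactSupport hs (μ := m)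
  have hzero : ρ (integrateRight (density m h hc hs) f) = 0 :=
    DFunLike.congr_fun (hρ _ (isTranslationContinuous_density m h hc hs)) f
  have hnorm : ‖integrateRight (density m h hc hs) f - ((∫ t, h t ∂m : ℝ) : ℂ) • f‖
      ≤ (∫ t, h t ∂m) * (δ / (‖ρ‖ + 1)) := by
    refine norm_le_of (by positivity) fun s => ?_
    have hv : (integrateRight (density m h hc hs) f - ((∫ t, h t ∂m : ℝ) : ℂ) • f) s
        = ∫ t, h t • (f (s * t) - f s) ∂m := by
      have hi : Integrable (fun t => h t • f (s * t)) m :=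
        (hc.smul ((map_continuous f).comp (continuous_const_mul s))).integrable_of_hasCompactSupport
          hs.smul_right
      have hi' : Integrable (fun t => h t • f s) m :=
        (hc.smul continuous_const).integrable_of_hasCompactSupport hs.smul_right
      simp only [smul_sub]
      rw [integral_sub hi hi', integral_smul_const]
      rfl
    rw [hv, ← integral_mul_const]
    refine norm_integral_le_of_norm_le (hint.mul_const _) (.of_forall fun t => ?_)
    rw [norm_smul, Real.norm_of_nonneg (h01 t).1]
    by_cases ht : t ∈ U
    · exact mul_le_mul_of_nonneg_left (hU t ht s) (h01 t).1
    · have : h t = 0 := hh0 ht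
      simp [this]
  have hfin := (ρ.le_opNorm _).trans (mul_le_mul_of_nonneg_left hnorm (norm_nonneg ρ))
  rw [map_sub, hzero, zero_sub, norm_neg, map_smul, norm_smul, Complex.norm_real,
    Real.norm_of_nonneg hpos.le, mul_left_comm] at hfin
  have h2 := le_of_mul_le_mul_left hfin hpos
  have h3 : ‖ρ‖ * (δ / (‖ρ‖ + 1)) ≤ δ := by
    rw [mul_div_assoc', div_le_iff₀ (by positivity)]
    nlinarith [norm_nonneg ρ]
  linarith

end Group

/-! ### From point masses to all measures -/

section Isomorphism

variable {G H : Type*}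
  [TopologicalSpace G] [Group G] [IsTopologicalGroup G] [LocallyCompactSpace G] [T2Space G]
  [TopologicalSpace H] [Group H] [IsTopologicalGroup H] [LocallyCompactSpace H] [T2Space H]

/-- A group isomorphism induced on point masses by an isomorphism of measure algebras is
continuous. -/
theorem continuous_of_map_dirac (θ : M G ≃A[ℂ] M H) (α : G ≃* H)
    (hα : ∀ s, θ (dirac s) = dirac (α s)) : Continuous α := by
  refine continuous_of_continuousAt_one α ?_
  rw [ContinuousAt, map_one, tendsto_iff_ultrafilter]
  intro U hU
  have hlim : ∀ μ : M G, IsTranslationContinuous μ → ∀ f : C₀(H, ℂ),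
      Tendsto (fun s => integrateRight (θ μ) f (α s)) U (𝓝 (θ μ f)) := by
    intro μ hμ f
    have h1 : Continuous fun s : G => θ (dirac s * μ) f :=
      ((ContinuousLinearMap.apply ℂ ℂ f).continuous.comp θ.continuous).comp hμ
    have h2 := (h1.tendsto 1).mono_left hU
    simp only [dirac_one, one_mul, map_mul, hα, dirac_mul_apply] at h2
    exact h2
  obtain ⟨μ, hμ, hμ0⟩ : ∃ μ : M G, IsTranslationContinuous μ ∧ μ ≠ 0 := by
    by_contra! h
    refine dirac_ne_zero (1 : G) (eq_zero_of_mul_isTranslationContinuous fun μ hμ => ?_)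
    rw [h μ hμ, mul_zero]
  obtain ⟨f, hf⟩ : ∃ f, θ μ f ≠ 0 := by
    by_contra! h
    exact hμ0 (θ.injective ((ContinuousLinearMap.ext h).trans (map_zero θ).symm))
  -- The image ultrafilter cannot escape to infinity: a C₀(H) function would then tend along it both
  -- to 0 and to `θ μ f ≠ 0`.
  obtain ⟨K, hK, hKU⟩ : ∃ K : Set H, IsCompact K ∧ K ∈ U.map α := by
    by_contra! h
    have hle : Tendsto α U (cocompact H) := fun s hs => by
      obtain ⟨K, hK, hKs⟩ := mem_cocompact.1 hs
      have := Ultrafilter.compl_mem_iff_notMem.2 (h K hK)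
      exact mem_of_superset this hKs
    exact hf (tendsto_nhds_unique (hlim μ hμ f)
      ((ZeroAtInftyContinuousMapClass.zero_at_infty (integrateRight (θ μ) f)).comp hle))
  obtain ⟨t, -, ht⟩ := hK.ultrafilter_le_nhds' _ hKU
  have ht' : Tendsto α U (𝓝 t) := ht
  suffices h : t = 1 by rwa [h] at ht'
  obtain ⟨r, rfl⟩ := α.surjective t
  -- The limit `t = α r` satisfies `δ_t * θ(μ) = θ(μ)` for every translation-continuous `μ`; pulled
  -- back by `θ`, this says that `δ_r - 1` annihilates all of them.
  have hr : (dirac r - 1 : M G) = 0 := by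
    refine eq_zero_of_mul_isTranslationContinuous fun μ hμ => EquivLike.injective θ ?_
    rw [sub_mul, one_mul, map_sub, map_mul, hα, map_zero, sub_eq_zero]
    refine ContinuousLinearMap.ext fun f => ?_
    exact tendsto_nhds_unique
      (((map_continuous (integrateRight (θ μ) f)).tendsto _).comp ht') (hlim μ hμ f)
  rw [sub_eq_zero, ← dirac_one] at hr
  rw [dirac_injective hr, map_one]

/-- An isomorphism of measure algebras given on point masses by a topological isomorphism is the
push-forward along it. -/
theorem apply_eq_of_map_dirac (θ : M G ≃A[ℂ] M H) (α : G ≃ₜ* H)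
    (hα : ∀ s, θ (dirac s) = dirac (α s)) (ν : M G) :
    θ ν = pushforward α.toHomeomorph.toCocompactMap ν := by
  obtain ⟨ρ, hρ⟩ := θ.surjective (θ ν - pushforward α.toHomeomorph.toCocompactMap ν)
  suffices h : ρ = 0 by
    rw [h, map_zero] at hρ
    exact sub_eq_zero.1 hρ.symm
  refine eq_zero_of_mul_isTranslationContinuous fun μ hμ => EquivLike.injective θ ?_
  rw [map_mul, hρ, map_zero, sub_mul, sub_eq_zero, ← map_mul]
  refine ContinuousLinearMap.ext fun f => ?_
  rw [← sub_eq_zero, ← norm_eq_zero]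
  refine le_antisymm (le_of_forall_pos_le_add fun δ hδ => ?_) (norm_nonneg _)
  -- The same finite sum `σ` serves twice: tested against `φ` it approximates `(α_*(ν) * θ(μ)) f`,
  -- and tested against all evaluations at `g` it approximates `ν * μ` in norm. The total error is
  -- `2 * ‖φ‖ * ε`.
  let φ : StrongDual ℂ (M G) :=
    adjointAt (θ.toContinuousLinearEquiv.toContinuousLinearMap) f
  have hφ : ∀ σ, φ σ = θ σ f := fun _ => rfl
  have hε : 0 < δ / (2 * ‖φ‖ + 1) := by positivity
  obtain ⟨n, c, x, hx⟩ := exists_sum_approx ν hμ (norm_nonneg μ)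
    (fun s => norm_dirac_mul_le s μ) hε
  set ε := δ / (2 * ‖φ‖ + 1) with hεdef
  set σ : M G := ∑ j, c j • (dirac (x j) * μ) with hσ
  have h1 : ‖pushforward α.toHomeomorph.toCocompactMap ν (integrateRight (θ μ) f) - φ σ‖
      ≤ ε * ‖φ‖ := by
    refine hx φ ((integrateRight (θ μ) f).comp α.toHomeomorph.toCocompactMap) fun s => ?_
    rw [hφ, map_mul, hα, dirac_mul_apply]
    rfl
  have h2 : ‖ν * μ - σ‖ ≤ ε := by
    refine ContinuousLinearMap.opNorm_le_bound _ hε.le fun g => ?_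
    have h3 := hx (ContinuousLinearMap.apply ℂ ℂ g) (integrateRight μ g) fun s => rfl
    refine h3.trans ?_
    gcongr
    refine ContinuousLinearMap.opNorm_le_bound _ (norm_nonneg _) fun τ => ?_
    rw [mul_comm]
    exact τ.le_opNorm g
  have h4 : ‖φ (ν * μ) - φ σ‖ ≤ ‖φ‖ * ε := by
    rw [← map_sub]
    exact (φ.le_opNorm _).trans (by gcongr)
  have h5 := norm_sub_le_norm_sub_add_norm_sub (φ (ν * μ)) (φ σ)
    (pushforward α.toHomeomorph.toCocompactMap ν (integrateRight (θ μ) f))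
  rw [norm_sub_rev (φ σ)] at h5
  have h6 : ε * (2 * ‖φ‖ + 1) = δ := by rw [hεdef]; field_simp
  rw [hφ (ν * μ)] at h4 h5
  rw [mul_apply]
  linarith

end Isomorphism

end MeasureAlgebra

end

/-! ### The main theorem -/

open MeasureAlgebra in
theorem proposition3p1 {G H : Type*}
    [TopologicalSpace G] [Group G] [IsTopologicalGroup G] [LocallyCompactSpace G] [T2Space G]
    [TopologicalSpace H] [Group H] [IsTopologicalGroup H] [LocallyCompactSpace H] [T2Space H]
    (θ : M G ≃A[ℂ] M H)
    (hθ : ∀ μ : M G, tensorSquare (θ.toContinuousLinearEquiv.toContinuousLinearMap) (Γ G μ) = Γ H (θ μ)) :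
    (∃ α : G ≃ₜ* H, ∀ (μ : M G) (f : C₀(H, ℂ)),
        θ μ f = μ (f.comp α.toHomeomorph.toCocompactMap)) ∧
      Continuous fun μ : WeakDual ℂ C₀(G, ℂ) =>
        StrongDual.toWeakDual (θ (WeakDual.toStrongDual μ)) := by
  have hθ' : ∀ ν : M H, tensorSquare (θ.symm.toContinuousLinearEquiv.toContinuousLinearMap)
      (Γ H ν) = Γ G (θ.symm ν) := fun ν => by
    obtain ⟨μ, rfl⟩ := θ.surjective ν
    exact tensorSquare_Γ_of_inverse (θ := θ.toContinuousLinearEquiv.toContinuousLinearMap)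
      (ψ := θ.symm.toContinuousLinearEquiv.toContinuousLinearMap)
      (fun μ => θ.symm_apply_apply μ) hθ μ
  choose a ha using fun s => exists_map_dirac_eq
    (θ := θ.toContinuousLinearEquiv.toContinuousLinearMap) θ.injective hθ s
  choose b hb using fun t => exists_map_dirac_eq
    (θ := θ.symm.toContinuousLinearEquiv.toContinuousLinearMap) θ.symm.injective hθ' t
  replace ha : ∀ s, θ (dirac s) = dirac (a s) := ha
  replace hb : ∀ t, θ.symm (dirac t) = dirac (b t) := hb
  let β : G ≃* H :=
    { toFun := a
      invFun := b
      left_inv := fun s => dirac_injective (by rw [← hb, ← ha, θ.symm_apply_apply])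
      right_inv := fun t => dirac_injective (by rw [← ha, ← hb, θ.apply_symm_apply])
      map_mul' := fun s t => dirac_injective (by
        rw [← ha, ← dirac_mul_dirac, map_mul, ha, ha, dirac_mul_dirac]) }
  let α : G ≃ₜ* H :=
    { β with
      continuous_toFun := continuous_of_map_dirac θ β ha
      continuous_invFun := continuous_of_map_dirac θ.symm β.symm hb }
  have hα : ∀ (μ : M G) (f : C₀(H, ℂ)), θ μ f = μ (f.comp α.toHomeomorph.toCocompactMap) :=
    fun μ f => DFunLike.congr_fun (apply_eq_of_map_dirac θ α ha μ) f
  refine ⟨⟨α, hα⟩, WeakDual.continuous_of_continuous_eval fun f => ?_⟩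
  have h : ∀ μ : WeakDual ℂ C₀(G, ℂ),
      (StrongDual.toWeakDual (θ (WeakDual.toStrongDual μ))) f
        = μ (f.comp α.toHomeomorph.toCocompactMap) := fun μ => hα _ f
  simp only [h]
  exact WeakDual.eval_continuous _
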